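/- There are absolute constants $C_0,a,K>0$ such that the following holds for every real $C\ge C_0$ (which may depend on the graph). Let $G=(V,E)$ be a finite simple graph with $n=|V|\ge 2$ vertices, edge connectivity $\lambda$ (the minimum, over all $S\subseteq V$ with $S\neq\emptyset$ and $S\neq V$, of the number of edges between $S$ and $V\setminus S$) and minimum degree $\delta$, and suppose that $C\log n\le\lambda$, where $\log$ is the natural logarithm. 1. (Edge sampling.) Let $G'=(V,E')$ be the random subgraph in which each edge $e\in E$ is included in $E'$ independently with probability $p=C\log n/\lambda$. Then with probability at least $1-n^{-aC}$, the graph $G'$ is a connected spanning subgraph of $G$ with diameter at most $K\cdot C\,n\log n/\delta$. 2. (Random partition.) Let $\lambda'=\lfloor\lambda/(C\log n)\rfloor\ge 1$, and partition the edges of $G$ into $\lambda'$ edge-disjoint subgraphs $G_1=(V,E_1),\dots,G_{\lambda'}=(V,E_{\lambda'})$ by putting each edge independently into a uniformly random one of them. Then with probability at least $1-n^{-aC}$, for all $i\in\{1,\dots,\lambda'\}$ simultaneously, $G_i$ is a connected spanning subgraph of $G$ with diameter at most $K\cdot C\,n\log n/\delta$. -/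

import Mathlib

namespace SimpleGraph

/-- The edges of `G` with one endpoint in `S` and the other outside `S`. -/
def cutEdges {V : Type*} (G : SimpleGraph V) (S : Set V) : Set (Sym2 V) :=
  {e | e ∈ G.edgeSet ∧ ∃ u ∈ S, ∃ v ∉ S, e = s(u, v)}

/-- The edge connectivity of a finite graph on at least two vertices: the size of a minimum cut,
over all vertex sets `S` with both `S` and its complement nonempty. -/
noncomputable def edgeConnectivity {V : Type*} (G : SimpleGraph V) : ℕ :=
  sInf {k | ∃ S : Set V, S.Nonempty ∧ Sᶜ.Nonempty ∧ (G.cutEdges S).ncard = k}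

/-- The subgraph of `G` on the whole vertex set `V` whose edges are exactly those in `F`. -/
def spanningSubgraphOf {V : Type*} (G : SimpleGraph V) (F : Set G.edgeSet) : SimpleGraph V :=
  SimpleGraph.fromEdgeSet (Subtype.val '' F)

theorem edgeSet_spanningSubgraphOf {V : Type*} (G : SimpleGraph V) (F : Set G.edgeSet) :
    (G.spanningSubgraphOf F).edgeSet = Subtype.val '' F := by
  rw [spanningSubgraphOf, edgeSet_fromEdgeSet, sdiff_eq_left, Set.disjoint_left]
  rintro _ ⟨e, -, rfl⟩
  exact G.not_isDiag_of_mem_edgeSet e.2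

end SimpleGraph

/-! Connectivity: let `k` be the number of components of the sampled graph and follow `k * (k - 1)`,
a potential that vanishes once the graph is connected. Each of `k ≥ 2` components is left by at
least `λ` edges of `G` and an edge leaves at most two components, so at least `k * λ / 2` edges
cross. Adding one lowers the potential by at least `2 * (k - 1)`, so the total drop over all missing
edges is at least `λ` times the potential. Averaging over layers of edge sets
(`sum_mul_pow_mul_pow_le`) bounds the expected potential by `n ^ 2 * (1 - p) ^ λ`, and Markov's
inequality finishes; no counting of small cuts is needed.

Diameter: if `4 * #S ≤ δ` and `#T = #S`, at least `#S * δ / 2` edges run from `S` to outside `S ∪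
T`. A union bound over `S` and `T` shows that, with high probability, every such `S` at least
doubles when its sampled neighbours are added. Balls then exceed `δ / 4` vertices at radius `O(log
n)`, and packing disjoint balls along a geodesic gives diameter `O(n log n / δ)`.

Partition: each class is a sample with `p = 1 / λ'`, which is at least `C log n / λ`; a union bound
over the at most `n` classes costs one power of `n`. -/

open Finset

/-! ### Potentials on random subsets -/

/-- Double counting of the pairs consisting of a finite set and one of its elements. -/
theorem Finset.succ_mul_sum_powersetCard_succ {E : Type*} [Fintype E] [DecidableEq E]
    (g : Finset E → ℕ) (k : ℕ) :
    (k + 1) * ∑ F ∈ powersetCard (k + 1) univ, g F =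
      ∑ F ∈ powersetCard k univ, ∑ e ∈ Fᶜ, g (insert e F) := by
  have h : (k + 1) * ∑ F ∈ powersetCard (k + 1) (univ : Finset E), g F =
      ∑ F ∈ powersetCard (k + 1) (univ : Finset E), ∑ _e ∈ F, g F := by
    rw [mul_sum]
    refine sum_congr rfl fun F hF => ?_
    rw [sum_const, (mem_powersetCard.1 hF).2, smul_eq_mul]
  rw [h, sum_sigma', sum_sigma']
  refine sum_bij' (fun x _ => ⟨x.1.erase x.2, x.2⟩) (fun x _ => ⟨insert x.2 x.1, x.2⟩)
    ?_ ?_ ?_ ?_ ?_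
  · rintro ⟨F, e⟩ hx
    simp only [mem_sigma, mem_powersetCard, subset_univ, true_and, mem_compl] at hx ⊢
    rw [card_erase_of_mem hx.2, hx.1]
    simp
  · rintro ⟨F, e⟩ hx
    simp only [mem_sigma, mem_powersetCard, subset_univ, true_and, mem_compl] at hx ⊢
    rw [card_insert_of_notMem hx.2, hx.1]
    simp
  · rintro ⟨F, e⟩ hx
    simp only [mem_sigma] at hx
    simp [insert_erase hx.2]
  · rintro ⟨F, e⟩ hx
    simp only [mem_sigma, mem_compl] at hx
    simp [erase_insert hx.2]
  · rintro ⟨F, e⟩ hx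
    simp only [mem_sigma] at hx
    simp [insert_erase hx.2]

/-- If adding a uniformly random missing element decreases `g` at rate at least `l`, then the layer
sums of `g` are dominated by binomial coefficients. -/
theorem Finset.sum_powersetCard_le_choose {E : Type*} [Fintype E] [DecidableEq E]
    (g : Finset E → ℕ) (l : ℕ)
    (hg : ∀ F, ∑ e ∈ Fᶜ, g (insert e F) + l * g F ≤ #Fᶜ * g F) (k : ℕ) :
    ∑ F ∈ powersetCard k univ, g F ≤ g ∅ * (Fintype.card E - l).choose k := by
  induction k with
  | zero => simp
  | succ k ih =>
    -- The factor `(card E - l - k) / (k + 1)` is the ratio of consecutive binomial coefficients of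
    -- `card E - l`.
    have h1 : (k + 1) * ∑ F ∈ powersetCard (k + 1) univ, g F ≤
        (Fintype.card E - l - k) * ∑ F ∈ powersetCard k univ, g F := by
      rw [succ_mul_sum_powersetCard_succ, mul_sum]
      refine sum_le_sum fun F hF => ?_
      have h2 := hg F
      rw [card_compl, (mem_powersetCard.1 hF).2] at h2
      rw [Nat.sub_right_comm, Nat.sub_mul]
      omega
    have h3 := (h1.trans (Nat.mul_le_mul_left _ ih))
    have h4 := Nat.choose_succ_right_eq (Fintype.card E - l) k
    refine Nat.le_of_mul_le_mul_left (h3.trans (le_of_eq ?_)) k.succ_pos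
    calc _ = g ∅ * ((Fintype.card E - l).choose k * (Fintype.card E - l - k)) := by ring
      _ = _ := by rw [← h4]; ring

/-- The expectation of `g` on a `p`-random set, when adding a random element decreases `g` at rate
at least `l`. -/
theorem Finset.sum_mul_pow_mul_pow_le {E : Type*} [Fintype E] [DecidableEq E]
    (g : Finset E → ℕ) (l : ℕ)
    (hg : ∀ F, ∑ e ∈ Fᶜ, g (insert e F) + l * g F ≤ #Fᶜ * g F)
    (hl : l ≤ Fintype.card E) {p : ℝ} (hp : 0 ≤ p) (hp1 : p ≤ 1) :
    ∑ F : Finset E, p ^ #F * (1 - p) ^ #Fᶜ * (g F : ℝ) ≤ g ∅ * (1 - p) ^ l := by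
  have hq : 0 ≤ 1 - p := by linarith
  set m := Fintype.card E with hm
  have hlayer : ∀ k ∈ range (m + 1),
      ∑ F ∈ powersetCard k (univ : Finset E), p ^ #F * (1 - p) ^ #Fᶜ * (g F : ℝ) ≤
        p ^ k * (1 - p) ^ (m - k) * (g ∅ * (m - l).choose k) := by
    intro k _
    have h := sum_powersetCard_le_choose g l hg k
    have h' : (∑ F ∈ powersetCard k (univ : Finset E), (g F : ℝ)) ≤ g ∅ * (m - l).choose k := by
      exact_mod_cast h
    rw [sum_congr rfl (g := fun F => p ^ k * (1 - p) ^ (m - k) * (g F : ℝ)), ← mul_sum]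
    · exact mul_le_mul_of_nonneg_left h' (by positivity)
    · intro F hF
      rw [card_compl, (mem_powersetCard.1 hF).2]
  calc ∑ F : Finset E, p ^ #F * (1 - p) ^ #Fᶜ * (g F : ℝ)
      = ∑ k ∈ range (m + 1), ∑ F ∈ powersetCard k (univ : Finset E),
          p ^ #F * (1 - p) ^ #Fᶜ * (g F : ℝ) := by
        rw [← powerset_univ, sum_powerset, card_univ]
    _ ≤ ∑ k ∈ range (m + 1), p ^ k * (1 - p) ^ (m - k) * (g ∅ * (m - l).choose k) :=
        sum_le_sum hlayer
    _ = ∑ k ∈ range (m - l + 1), p ^ k * (1 - p) ^ (m - k) * (g ∅ * (m - l).choose k) := by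
        symm
        refine sum_subset (range_mono (by omega)) fun k _ hk => ?_
        rw [Nat.choose_eq_zero_of_lt (by simpa using hk)]
        simp
    -- Once `(1 - p) ^ l` is pulled out, the sum is the expansion of `(p + (1 - p)) ^ (m - l) = 1`.
    _ = ∑ k ∈ range (m - l + 1),
          (g ∅ * (1 - p) ^ l) * (p ^ k * (1 - p) ^ (m - l - k) * (m - l).choose k) := by
        refine sum_congr rfl fun k hk => ?_
        have hk' : m - k = l + (m - l - k) := by
          have := mem_range.1 hk
          omega
        rw [hk', pow_add]
        ring
    _ = g ∅ * (1 - p) ^ l := by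
        rw [← mul_sum, ← add_pow]
        simp

/-! ### Components, cuts and the drop of the potential -/

namespace SimpleGraph

variable {V : Type*} (G : SimpleGraph V)

theorem spanningSubgraphOf_adj {F : Set G.edgeSet} {u v : V} :
    (G.spanningSubgraphOf F).Adj u v ↔ ∃ h : G.Adj u v, (⟨s(u, v), h⟩ : G.edgeSet) ∈ F := by
  rw [← mem_edgeSet, edgeSet_spanningSubgraphOf]
  constructor
  · rintro ⟨e, he, h⟩
    have h' : G.Adj u v := by
      rw [← mem_edgeSet, ← h]
      exact e.2
    refine ⟨h', ?_⟩
    rwa [show (⟨s(u, v), h'⟩ : G.edgeSet) = e from Subtype.ext h.symm]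
  · rintro ⟨h, he⟩
    exact ⟨_, he, rfl⟩

theorem spanningSubgraphOf_mono {F F' : Set G.edgeSet} (h : F ⊆ F') :
    G.spanningSubgraphOf F ≤ G.spanningSubgraphOf F' := by
  intro u v huv
  rw [spanningSubgraphOf_adj] at huv ⊢
  exact ⟨huv.1, h huv.2⟩

/-- The number of connected components of the spanning subgraph with edge set `F`. -/
noncomputable def numComponents (F : Set G.edgeSet) : ℕ :=
  Nat.card (G.spanningSubgraphOf F).ConnectedComponent

theorem ConnectedComponent.map_ofLE_surjective {H H' : SimpleGraph V} (h : H ≤ H') :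
    Function.Surjective (ConnectedComponent.map (Hom.ofLE h)) :=
  ConnectedComponent.ind fun v => ⟨H.connectedComponentMk v, rfl⟩

theorem numComponents_anti [Finite V] {F F' : Set G.edgeSet} (h : F ⊆ F') :
    G.numComponents F' ≤ G.numComponents F :=
  Nat.card_le_card_of_surjective _
    (ConnectedComponent.map_ofLE_surjective (G.spanningSubgraphOf_mono h))

/-- The edge `e` joins two different components of the spanning subgraph with edge set `F`. -/
def Crosses (F : Set G.edgeSet) (e : G.edgeSet) : Prop :=
  ∃ u v, e.1 = s(u, v) ∧ ¬ (G.spanningSubgraphOf F).Reachable u v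

variable {G}

theorem Crosses.notMem {F : Set G.edgeSet} {e : G.edgeSet} (h : G.Crosses F e) : e ∉ F := by
  obtain ⟨u, v, he, h⟩ := h
  intro hF
  refine h (Adj.reachable ?_)
  rw [← mem_edgeSet, edgeSet_spanningSubgraphOf]
  exact ⟨e, hF, he⟩

/-- The natural map on components is onto, and it identifies the two components that `e` joins. -/
theorem Crosses.numComponents_lt [Finite V] {F : Set G.edgeSet} {e : G.edgeSet}
    (h : G.Crosses F e) : G.numComponents (insert e F) < G.numComponents F := by
  classical
  have hle := G.spanningSubgraphOf_mono (Set.subset_insert e F)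
  obtain ⟨u, v, he, h⟩ := h
  have := Fintype.ofFinite (G.spanningSubgraphOf F).ConnectedComponent
  have := Fintype.ofFinite (G.spanningSubgraphOf (insert e F)).ConnectedComponent
  rw [numComponents, numComponents, Nat.card_eq_fintype_card, Nat.card_eq_fintype_card]
  refine Fintype.card_lt_of_surjective_not_injective _
    (ConnectedComponent.map_ofLE_surjective hle) fun hinj => h ?_
  refine ConnectedComponent.exact (hinj ?_)
  refine ConnectedComponent.sound (Adj.reachable ?_)
  change (G.spanningSubgraphOf (insert e F)).Adj u v
  rw [← mem_edgeSet, edgeSet_spanningSubgraphOf]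
  exact ⟨e, Set.mem_insert _ _, he⟩

theorem numComponents_le_card [Finite V] (F : Set G.edgeSet) : G.numComponents F ≤ Nat.card V :=
  Nat.card_le_card_of_surjective _ Quot.mk_surjective

theorem connected_of_numComponents_le_one [Finite V] [Nonempty V] {F : Set G.edgeSet}
    (h : G.numComponents F ≤ 1) : (G.spanningSubgraphOf F).Connected := by
  have := Finite.card_le_one_iff_subsingleton.1 h
  exact (connected_iff _).2 ⟨fun u v => ConnectedComponent.exact (Subsingleton.elim _ _), ‹_›⟩

theorem edgeConnectivity_le_ncard_cutEdges {S : Set V} (h : S.Nonempty) (h' : Sᶜ.Nonempty) :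
    G.edgeConnectivity ≤ (G.cutEdges S).ncard :=
  Nat.sInf_le ⟨S, h, h', rfl⟩

theorem ncard_cutEdges [Fintype G.edgeSet] (S : Set V) [DecidablePred (· ∈ G.cutEdges S)] :
    (G.cutEdges S).ncard = #{e : G.edgeSet | e.1 ∈ G.cutEdges S} := by
  have : G.cutEdges S =
      Subtype.val '' (({e : G.edgeSet | e.1 ∈ G.cutEdges S} : Finset G.edgeSet) : Set G.edgeSet) := by
    ext e
    constructor
    · intro h
      exact ⟨⟨e, h.1⟩, by simpa using h, rfl⟩
    · rintro ⟨e, he, rfl⟩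
      simpa using he
  conv_lhs => rw [this]
  rw [Set.ncard_image_of_injective _ Subtype.val_injective, Set.ncard_coe_finset]

/-- Needed so that `card E - l` in the binomial estimate is a genuine subtraction when `l` is the
edge connectivity. -/
theorem edgeConnectivity_le_card_edgeSet [Finite V] [Nontrivial V] [Fintype G.edgeSet] :
    G.edgeConnectivity ≤ Fintype.card G.edgeSet := by
  classical
  obtain ⟨u, v, huv⟩ := exists_pair_ne V
  refine (edgeConnectivity_le_ncard_cutEdges (S := {u}) ⟨u, rfl⟩ ⟨v, fun h => huv h.symm⟩).trans ?_
  rw [ncard_cutEdges]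
  exact card_le_univ _

theorem edgeConnectivity_le_minDegree [Fintype V] [Nontrivial V] [DecidableRel G.Adj] :
    G.edgeConnectivity ≤ G.minDegree := by
  classical
  obtain ⟨u, hu⟩ := G.exists_minimal_degree_vertex
  obtain ⟨v, hv⟩ := exists_ne u
  refine (edgeConnectivity_le_ncard_cutEdges (S := {u}) ⟨u, rfl⟩ ⟨v, hv⟩).trans ?_
  rw [hu, ← card_neighborFinset_eq_degree, ← Set.ncard_coe_finset]
  refine (Set.ncard_le_ncard (t := (fun w => s(u, w)) '' (G.neighborFinset u : Set V)) ?_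
    (Set.toFinite _)).trans (Set.ncard_image_le (Set.toFinite _))
  rintro _ ⟨he, x, rfl, w, -, rfl⟩
  exact ⟨w, by simpa using he, rfl⟩

/-- A spanning subgraph with `k ≥ 2` components is crossed by at least `k * edgeConnectivity / 2`
edges of the graph. -/
theorem numComponents_mul_edgeConnectivity_le [Finite V] [Fintype G.edgeSet] (F : Set G.edgeSet)
    [DecidablePred (G.Crosses F)] (h2 : 2 ≤ G.numComponents F) :
    G.numComponents F * G.edgeConnectivity ≤ #{e | G.Crosses F e} * 2 := by
  classical
  set H := G.spanningSubgraphOf F with hH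
  have := Fintype.ofFinite H.ConnectedComponent
  have hcard : G.numComponents F = #(univ : Finset H.ConnectedComponent) := by
    rw [numComponents, Nat.card_eq_fintype_card, card_univ]
  rw [hcard]
  -- Double count incidences between components and the crossing edges that leave them.
  refine card_mul_le_card_mul (fun (c : H.ConnectedComponent) (e : G.edgeSet) =>
    e.1 ∈ G.cutEdges c.supp) ?_ ?_
  · intro c _
    obtain ⟨d, hd⟩ : ∃ d, d ≠ c := by
      have : Nontrivial H.ConnectedComponent := by
        rw [← Finite.one_lt_card_iff_nontrivial]
        exact h2
      exact exists_ne c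
    have hne : c.suppᶜ.Nonempty := by
      obtain ⟨v, hv⟩ := d.nonempty_supp
      exact ⟨v, fun hv' => hd (ConnectedComponent.eq_of_common_vertex hv hv')⟩
    refine (edgeConnectivity_le_ncard_cutEdges c.nonempty_supp hne).trans ?_
    rw [ncard_cutEdges]
    refine card_le_card fun e he => ?_
    simp only [mem_filter, mem_univ, true_and, mem_bipartiteAbove] at he ⊢
    refine ⟨?_, he⟩
    obtain ⟨-, u, hu, v, hv, he⟩ := he
    refine ⟨u, v, he, fun hr => hv ?_⟩
    rw [ConnectedComponent.mem_supp_iff] at hu ⊢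
    rw [← hu]
    exact ConnectedComponent.sound hr.symm
  · intro e _
    obtain ⟨e, he⟩ := e
    induction e using Sym2.ind with
    | _ u v =>
    refine (card_le_card (t := {H.connectedComponentMk u, H.connectedComponentMk v}) ?_).trans
      card_le_two
    intro c hc
    simp only [mem_bipartiteBelow, mem_univ, true_and, mem_insert, mem_singleton] at hc ⊢
    obtain ⟨-, x, hx, y, -, hxy⟩ := hc
    rw [ConnectedComponent.mem_supp_iff] at hx
    rcases Sym2.eq_iff.1 hxy with ⟨rfl, -⟩ | ⟨-, rfl⟩
    · exact Or.inl hx.symm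
    · exact Or.inr hx.symm

/-- Adding a random edge decreases the number of ordered pairs of distinct components at rate at
least the edge connectivity. -/
theorem sum_numComponents_insert_add_le [Finite V] [Nonempty V] [Fintype G.edgeSet]
    [DecidableEq G.edgeSet] (F : Finset G.edgeSet) :
    ∑ e ∈ Fᶜ, G.numComponents ↑(insert e F) * (G.numComponents ↑(insert e F) - 1) +
      G.edgeConnectivity * (G.numComponents ↑F * (G.numComponents ↑F - 1)) ≤
        #Fᶜ * (G.numComponents ↑F * (G.numComponents ↑F - 1)) := by
  classical
  set k := G.numComponents ↑F with hk
  set D : Finset G.edgeSet := {e | G.Crosses ↑F e} with hD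
  have hDF : D ⊆ Fᶜ := by
    intro e he
    rw [hD, mem_filter] at he
    rw [mem_compl]
    exact_mod_cast he.2.notMem
  have hanti : ∀ e, G.numComponents ↑(insert e F) ≤ k := fun e =>
    G.numComponents_anti (by simp)
  -- The amount `2 * (k - 1)` is `k * (k - 1) - (k - 1) * (k - 2)`, the loss when the count falls by
  -- one.
  have hterm : ∀ e ∈ Fᶜ, G.numComponents ↑(insert e F) * (G.numComponents ↑(insert e F) - 1) +
      (if e ∈ D then 2 * (k - 1) else 0) ≤ k * (k - 1) := by
    intro e _
    split_ifs with he
    · rw [hD, mem_filter] at he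
      have h := he.2.numComponents_lt
      rw [← coe_insert] at h
      change _ < k at h
      obtain ⟨j, hj⟩ : ∃ j, k = j + 1 := ⟨k - 1, by omega⟩
      have h1 : G.numComponents ↑(insert e F) ≤ j := by omega
      have h2 := Nat.mul_le_mul h1 (Nat.sub_le_sub_right h1 1)
      rw [hj]
      refine (Nat.add_le_add_right h2 _).trans ?_
      rcases j with _ | j
      · simp
      · simp only [Nat.add_sub_cancel]
        nlinarith
    · exact Nat.mul_le_mul (hanti e) (Nat.sub_le_sub_right (hanti e) 1)
  have hsum := sum_le_sum hterm
  rw [sum_add_distrib, sum_const, smul_eq_mul, ← sum_filter, sum_const, smul_eq_mul,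
    filter_mem_eq_inter, inter_eq_right.2 hDF] at hsum
  refine le_trans (Nat.add_le_add_left ?_ _) hsum
  by_cases h2 : 2 ≤ k
  · have h := numComponents_mul_edgeConnectivity_le (F : Set G.edgeSet) h2
    calc G.edgeConnectivity * (k * (k - 1)) = (k * G.edgeConnectivity) * (k - 1) := by ring
      _ ≤ (#D * 2) * (k - 1) := Nat.mul_le_mul_right _ h
      _ = _ := by ring
  · have : k - 1 = 0 := by omega
    simp [this]

end SimpleGraph

/-! ### Expansion bounds the diameter -/

namespace SimpleGraph

variable {V : Type*} [Fintype V] {H : SimpleGraph V}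

/-- If every set of at most `m` vertices at least doubles when its neighbours are added, then balls
of radius `r` have at least `2 ^ r` or more than `m` vertices. -/
theorem Connected.two_pow_le_card_ball (hH : H.Connected) {m : ℕ}
    (hexp : ∀ S B : Finset V, S.Nonempty → S ⊆ B → (∀ x ∈ S, ∀ y, H.Adj x y → y ∈ B) →
      #S ≤ m → 2 * #S ≤ #B) (v : V) (r : ℕ) :
    2 ^ r ≤ #{x | H.dist v x ≤ r} ∨ m < #{x | H.dist v x ≤ r} := by
  induction r with
  | zero =>
    left
    rw [pow_zero, Nat.one_le_iff_ne_zero, Finset.card_ne_zero]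
    exact ⟨v, by simp⟩
  | succ r ih =>
    have hsub : (univ.filter fun x => H.dist v x ≤ r) ⊆
        univ.filter fun x => H.dist v x ≤ r + 1 := by
      intro x hx
      simp only [mem_filter, mem_univ, true_and] at hx ⊢
      omega
    by_cases hm : m < #{x | H.dist v x ≤ r}
    · exact Or.inr (hm.trans_le (card_le_card hsub))
    · left
      have h := ih.resolve_right hm
      refine le_trans ?_ (hexp {x | H.dist v x ≤ r} {x | H.dist v x ≤ r + 1} ⟨v, by simp⟩ hsub ?_
        (not_lt.1 hm))
      · rw [pow_succ']
        exact Nat.mul_le_mul_left 2 h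
      · intro x hx y hxy
        simp only [mem_filter, mem_univ, true_and] at hx ⊢
        have h1 := hH.dist_triangle (u := v) (v := x) (w := y)
        have h2 := dist_eq_one_iff_adj.2 hxy
        omega

/-- In a connected graph in which all balls of radius `r` have more than `m` vertices, disjoint
balls along a geodesic bound the diameter. -/
theorem Connected.diam_mul_le (hH : H.Connected) {m r : ℕ}
    (hball : ∀ v, m < #{x | H.dist v x ≤ r}) :
    H.diam * (m + 1) ≤ (2 * r + 1) * Fintype.card V := by
  classical
  have := hH.nonempty
  obtain ⟨u, v, huv⟩ := H.exists_dist_eq_diam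
  obtain ⟨p, hp⟩ := hH.exists_walk_length_eq_dist u v
  set D := H.diam
  have hget : ∀ i ≤ D, H.dist u (p.getVert i) = i := by
    intro i hi
    have h1 : H.dist u (p.getVert i) ≤ i := (dist_le (p.take i)).trans (by simp)
    have h2 : H.dist (p.getVert i) v ≤ D - i :=
      (dist_le (p.drop i)).trans (by simp [hp, huv])
    have h3 := hH.dist_triangle (u := u) (v := p.getVert i) (w := v)
    omega
  -- Centres are placed every `2 * r + 1` steps along the geodesic, starting at `u`, so that balls
  -- of radius `r` around them are disjoint.
  set N := D / (2 * r + 1) + 1 with hN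
  have hcard : #(range N) * (m + 1) ≤ Fintype.card V := by
    have hdisj : ((range N : Finset ℕ) : Set ℕ).PairwiseDisjoint fun i =>
        ({x | H.dist (p.getVert (i * (2 * r + 1))) x ≤ r} : Finset V) := by
      intro i hi j hj hij
      rw [Function.onFun, Finset.disjoint_left]
      intro x hxi hxj
      simp only [mem_filter, mem_univ, true_and] at hxi hxj
      have hbd : ∀ i, i ∈ (range N : Finset ℕ) → i * (2 * r + 1) ≤ D := by
        intro i hi
        rw [mem_range] at hi
        exact (Nat.mul_le_mul_right _ (by omega)).trans (Nat.div_mul_le_self D (2 * r + 1))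
      have ei := hget _ (hbd i (mem_coe.1 hi))
      have ej := hget _ (hbd j (mem_coe.1 hj))
      have t1 := hH.dist_triangle (u := u) (v := p.getVert (i * (2 * r + 1))) (w := x)
      have t2 := hH.dist_triangle (u := u) (v := x) (w := p.getVert (i * (2 * r + 1)))
      have t3 := hH.dist_triangle (u := u) (v := p.getVert (j * (2 * r + 1))) (w := x)
      have t4 := hH.dist_triangle (u := u) (v := x) (w := p.getVert (j * (2 * r + 1)))
      rw [dist_comm (u := x)] at t2 t4
      rcases lt_or_gt_of_ne hij with h | h
      · have := Nat.mul_le_mul_right (2 * r + 1) (Nat.succ_le_of_lt h)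
        rw [Nat.succ_mul] at this
        omega
      · have := Nat.mul_le_mul_right (2 * r + 1) (Nat.succ_le_of_lt h)
        rw [Nat.succ_mul] at this
        omega
    rw [← card_univ, ← smul_eq_mul]
    refine le_trans ?_ (card_le_univ ((range N).biUnion fun i =>
      ({x | H.dist (p.getVert (i * (2 * r + 1))) x ≤ r} : Finset V)))
    rw [card_biUnion hdisj]
    exact card_nsmul_le_sum _ _ _ fun i _ => hball _
  rw [card_range] at hcard
  have hD : D ≤ (2 * r + 1) * N := (Nat.lt_mul_div_succ D (by omega)).le
  calc D * (m + 1) ≤ (2 * r + 1) * N * (m + 1) := Nat.mul_le_mul_right _ hD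
    _ = (2 * r + 1) * (N * (m + 1)) := by ring
    _ ≤ _ := Nat.mul_le_mul_left _ hcard

/-- A connected graph in which all sets of at most `d / 4` vertices at least double when their
neighbours are added has diameter `O(n log n / d)`. -/
theorem Connected.diam_le_of_expansion [Nontrivial V] (hH : H.Connected) {d : ℕ} (hd : 0 < d)
    (hexp : ∀ S B : Finset V, S.Nonempty → S ⊆ B → (∀ x ∈ S, ∀ y, H.Adj x y → y ∈ B) →
      4 * #S ≤ d → 2 * #S ≤ #B) :
    (H.diam : ℝ) ≤ 32 * (Fintype.card V * Real.log (Fintype.card V) / d) := by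
  set n := Fintype.card V with hn
  have hn2 : 2 ≤ n := Fintype.one_lt_card
  -- This radius has `2 ^ r > n`, so the doubling alternative for balls is impossible.
  set r := Nat.log 2 n + 1 with hr
  have hball : ∀ v, d / 4 < #{x | H.dist v x ≤ r} := by
    intro v
    refine (hH.two_pow_le_card_ball (m := d / 4) (fun S B h1 h2 h3 h4 => hexp S B h1 h2 h3
      (by omega)) v r).resolve_left fun h => ?_
    have h1 : n < 2 ^ r := Nat.lt_pow_succ_log_self (by norm_num) n
    have h2 : #{x | H.dist v x ≤ r} ≤ n := card_le_univ _
    omega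
  have h := hH.diam_mul_le hball
  have h' : (H.diam : ℝ) * ((d / 4 : ℕ) + 1 : ℝ) ≤ (2 * r + 1) * n := by exact_mod_cast h
  have hd4 : (d : ℝ) / 4 ≤ ((d / 4 : ℕ) + 1 : ℝ) := by
    have : d ≤ 4 * (d / 4 + 1) := by omega
    have : (d : ℝ) ≤ 4 * ((d / 4 : ℕ) + 1 : ℝ) := by exact_mod_cast this
    linarith
  have hd0 : (0 : ℝ) < d := by exact_mod_cast hd
  have hlog2 : (0.6931471803 : ℝ) < Real.log 2 := Real.log_two_gt_d9
  have hrn : (Nat.log 2 n : ℝ) * Real.log 2 ≤ Real.log n := by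
    rw [← Real.log_pow]
    refine Real.log_le_log (by positivity) ?_
    exact_mod_cast Nat.pow_log_le_self 2 (by omega)
  have hln : Real.log 2 ≤ Real.log n := Real.log_le_log (by norm_num) (by exact_mod_cast hn2)
  -- Here `2 * r + 1 = 2 * Nat.log 2 n + 3` is at most `5 * log n / log 2`, and `5 / log 2 < 8`.
  have hr8 : (2 * r + 1 : ℝ) ≤ 8 * Real.log n := by
    rw [hr]
    push_cast
    have : (Nat.log 2 n : ℝ) ≥ 0 := by positivity
    nlinarith
  have hn0 : (0 : ℝ) ≤ n := by positivity
  rw [← mul_div_assoc, le_div_iff₀ hd0]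
  have h1 : (H.diam : ℝ) * (d / 4) ≤ 8 * Real.log n * n :=
    (mul_le_mul_of_nonneg_left hd4 (by positivity)).trans
      (h'.trans (mul_le_mul_of_nonneg_right hr8 hn0))
  linarith

end SimpleGraph

/-! ### Independent events -/

open MeasureTheory ProbabilityTheory in
-- Allows each event to be replaced by its complement, separately for each index.
theorem ProbabilityTheory.iIndepSet.measureReal_biInter_of_generateFrom {E Ω : Type*}
    [MeasurableSpace Ω] {P : Measure Ω} {A B : E → Set Ω} (hA : iIndepSet A P)
    (hB : ∀ e, MeasurableSet[MeasurableSpace.generateFrom {A e}] (B e)) (W : Finset E) :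
    P.real (⋂ e ∈ W, B e) = ∏ e ∈ W, P.real (B e) := by
  have h := ((iIndepSet_iff_iIndep A P).1 hA).meas_biInter (S := W) (fun e _ => hB e)
  rw [measureReal_def, h, ENNReal.toReal_prod]
  rfl

open MeasureTheory ProbabilityTheory in
/-- The probability that none of finitely many independent events of probability `p` occurs. -/
theorem ProbabilityTheory.iIndepSet.measureReal_forall_notMem {E Ω : Type*}
    [MeasurableSpace Ω] {P : Measure Ω} [IsProbabilityMeasure P] {A : E → Set Ω}
    (hA : iIndepSet A P) (hm : ∀ e, MeasurableSet (A e)) {p : ℝ} (hp : ∀ e, P.real (A e) = p)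
    (W : Finset E) : P.real {ω | ∀ e ∈ W, ω ∉ A e} = (1 - p) ^ #W := by
  have h := hA.measureReal_biInter_of_generateFrom (B := fun e => (A e)ᶜ)
    (fun e => (MeasurableSpace.measurableSet_generateFrom (Set.mem_singleton (A e))).compl) W
  rw [prod_congr rfl fun e _ => by rw [probReal_compl_eq_one_sub (hm e), hp e], prod_const] at h
  rw [← h]
  congr 1
  ext ω
  simp

open MeasureTheory ProbabilityTheory in
/-- The probability that `F` is the set of those events that occur, among finitely many
independent events of probability `p`. -/
theorem ProbabilityTheory.iIndepSet.measureReal_setOf_mem_eq {E Ω : Type*} [Fintype E]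
    [DecidableEq E] [MeasurableSpace Ω] {P : Measure Ω} [IsProbabilityMeasure P] {A : E → Set Ω}
    (hA : iIndepSet A P) (hm : ∀ e, MeasurableSet (A e)) {p : ℝ} (hp : ∀ e, P.real (A e) = p)
    (F : Finset E) : P.real {ω | {e | ω ∈ A e} = (F : Set E)} = p ^ #F * (1 - p) ^ #Fᶜ := by
  have h := hA.measureReal_biInter_of_generateFrom (B := fun e => if e ∈ F then A e else (A e)ᶜ)
    (fun e => by
      have h := MeasurableSpace.measurableSet_generateFrom (Set.mem_singleton (A e))
      split_ifs
      exacts [h, h.compl]) univ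
  have hval : ∀ e, P.real (if e ∈ F then A e else (A e)ᶜ) = if e ∈ F then p else 1 - p := by
    intro e
    split_ifs
    exacts [hp e, by rw [probReal_compl_eq_one_sub (hm e), hp e]]
  rw [prod_congr rfl fun e _ => hval e, prod_ite, prod_const, prod_const] at h
  have h1 : (univ.filter fun e => e ∈ F) = F := by ext; simp
  have h2 : (univ.filter fun e => e ∉ F) = Fᶜ := by ext; simp
  rw [h1, h2] at h
  rw [← h]
  congr 1
  ext ω
  simp only [Set.mem_ofPred_eq, Set.ext_iff, Set.mem_iInter, mem_coe, mem_univ, true_imp_iff]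
  refine forall_congr' fun e => ?_
  split_ifs with he <;> simp [he]

/-! ### Failure probabilities for edge sampling -/

namespace SimpleGraph

open MeasureTheory ProbabilityTheory

variable {V : Type*} [Fintype V] {G : SimpleGraph V}
  {Ω : Type*} [MeasurableSpace Ω] {P : Measure Ω} [IsProbabilityMeasure P]

/-- Sampling the edges with probability `p` leaves the graph disconnected with probability at most
`n ^ 2 * (1 - p) ^ edgeConnectivity`. -/
theorem measureReal_not_connected_le [Nontrivial V] {A : G.edgeSet → Set Ω}
    (hm : ∀ e, MeasurableSet (A e)) (hA : iIndepSet A P) {p : ℝ} (hp0 : 0 ≤ p) (hp1 : p ≤ 1)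
    (hp : ∀ e, P.real (A e) = p) :
    P.real {ω | ¬ (G.spanningSubgraphOf {e | ω ∈ A e}).Connected} ≤
      (Fintype.card V : ℝ) ^ 2 * (1 - p) ^ G.edgeConnectivity := by
  classical
  set g : Finset G.edgeSet → ℕ := fun F => G.numComponents ↑F * (G.numComponents ↑F - 1) with hg
  have hq : 0 ≤ 1 - p := by linarith
  set D : Finset (Finset G.edgeSet) :=
    univ.filter fun F => ¬ (G.spanningSubgraphOf (F : Set G.edgeSet)).Connected with hD
  have hg1 : ∀ F ∈ D, (1 : ℝ) ≤ g F := by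
    intro F hF
    have hF' := (mem_filter.1 hF).2
    have h2 : 2 ≤ G.numComponents (F : Set G.edgeSet) := by
      by_contra h
      exact hF' (connected_of_numComponents_le_one (by omega))
    have : 1 ≤ g F := Nat.mul_pos (by omega) (by omega)
    exact_mod_cast this
  have hg0 : (g ∅ : ℝ) ≤ (Fintype.card V : ℝ) ^ 2 := by
    have h := G.numComponents_le_card ((∅ : Finset G.edgeSet) : Set G.edgeSet)
    rw [Nat.card_eq_fintype_card] at h
    have : g ∅ ≤ Fintype.card V ^ 2 := by
      rw [sq]
      exact Nat.mul_le_mul h ((Nat.sub_le _ _).trans h)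
    exact_mod_cast this
  calc P.real {ω | ¬ (G.spanningSubgraphOf {e | ω ∈ A e}).Connected}
      ≤ P.real (⋃ F ∈ D, {ω | {e | ω ∈ A e} = (F : Set G.edgeSet)}) := by
        refine measureReal_mono (fun ω hω => ?_) (measure_ne_top _ _)
        have hcoe : ((Set.toFinite {e | ω ∈ A e}).toFinset : Set G.edgeSet) = {e | ω ∈ A e} :=
          Set.Finite.coe_toFinset _
        refine Set.mem_biUnion (x := (Set.toFinite {e | ω ∈ A e}).toFinset) ?_ hcoe.symm
        simp only [hD, coe_filter, mem_univ, true_and, Set.mem_ofPred_eq]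
        rwa [hcoe]
    _ ≤ ∑ F ∈ D, P.real {ω | {e | ω ∈ A e} = (F : Set G.edgeSet)} :=
        measureReal_biUnion_finset_le _ _
    -- Markov's inequality: the potential is at least one on every disconnected outcome.
    _ ≤ ∑ F ∈ D, p ^ #F * (1 - p) ^ #Fᶜ * (g F : ℝ) := by
        refine sum_le_sum fun F hF => ?_
        rw [hA.measureReal_setOf_mem_eq hm hp]
        exact le_mul_of_one_le_right (by positivity) (hg1 F hF)
    _ ≤ ∑ F : Finset G.edgeSet, p ^ #F * (1 - p) ^ #Fᶜ * (g F : ℝ) :=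
        sum_le_univ_sum_of_nonneg fun F => by positivity
    _ ≤ g ∅ * (1 - p) ^ G.edgeConnectivity :=
        sum_mul_pow_mul_pow_le g _ sum_numComponents_insert_add_le
          edgeConnectivity_le_card_edgeSet hp0 hp1
    _ ≤ _ := mul_le_mul_of_nonneg_right hg0 (by positivity)

/-- A set `S` of at most `δ / 4` vertices sends at least `#S * δ / 2` edges out of `S ∪ T` when
`T` has the same size as `S`. -/
theorem card_mul_minDegree_le [DecidableRel G.Adj] [DecidableEq V] {S T : Finset V}
    (hST : #T = #S) (hS : 4 * #S ≤ G.minDegree) :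
    #S * G.minDegree ≤
      2 * #{e : G.edgeSet | ∃ u ∈ S, ∃ v ∉ S ∪ T, e.1 = s(u, v)} := by
  set W : Finset G.edgeSet := {e : G.edgeSet | ∃ u ∈ S, ∃ v ∉ S ∪ T, e.1 = s(u, v)}
  -- Distinct pairs give distinct edges, because only the first endpoint lies in `S`.
  have h1 : #(S.sigma fun u => G.neighborFinset u \ (S ∪ T)) ≤ #(W.map (.subtype _)) := by
    refine card_le_card_of_injOn (fun x => s(x.1, x.2)) ?_ ?_
    · rintro ⟨u, v⟩ h
      simp only [coe_sigma, Set.mem_sigma_iff, mem_coe, mem_sdiff, mem_neighborFinset] at h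
      simp only [coe_map, Set.mem_image, mem_coe]
      exact ⟨⟨s(u, v), h.2.1⟩, mem_filter.2 ⟨mem_univ _, u, h.1, v, h.2.2, rfl⟩, rfl⟩
    · rintro ⟨u, v⟩ h ⟨u', v'⟩ h' heq
      simp only [coe_sigma, Set.mem_sigma_iff, mem_coe, mem_sdiff, mem_union, not_or] at h h'
      rcases Sym2.eq_iff.1 heq with ⟨rfl, rfl⟩ | ⟨rfl, rfl⟩
      · rfl
      · exact absurd h.1 h'.2.2.1
  rw [card_map, card_sigma] at h1
  have h2 : ∀ u ∈ S, G.minDegree - 2 * #S ≤ #(G.neighborFinset u \ (S ∪ T)) := by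
    intro u _
    have h3 := le_card_sdiff (S ∪ T) (G.neighborFinset u)
    have h4 := card_union_le S T
    have h5 := G.minDegree_le_degree u
    rw [card_neighborFinset_eq_degree] at h3
    omega
  have h3 := (card_nsmul_le_sum _ _ _ h2).trans h1
  rw [smul_eq_mul] at h3
  calc #S * G.minDegree ≤ #S * (2 * (G.minDegree - 2 * #S)) :=
        Nat.mul_le_mul_left _ (by omega)
    _ = 2 * (#S * (G.minDegree - 2 * #S)) := by ring
    _ ≤ _ := Nat.mul_le_mul_left _ h3

/-- The probability that some small set of vertices fails to double in the sampled graph. -/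
theorem measureReal_not_expanding_le [Nonempty V] [DecidableRel G.Adj] {A : G.edgeSet → Set Ω}
    (hm : ∀ e, MeasurableSet (A e)) (hA : iIndepSet A P) {p : ℝ} (hp0 : 0 ≤ p) (hp1 : p ≤ 1)
    (hp : ∀ e, P.real (A e) = p) {x : ℝ} (hx : Real.exp (-(p * G.minDegree / 2)) ≤ x)
    (hx1 : (Fintype.card V : ℝ) ^ 2 * x ≤ 1) :
    P.real {ω | ¬ ∀ S B : Finset V, S.Nonempty → S ⊆ B →
      (∀ u ∈ S, ∀ v, (G.spanningSubgraphOf {e | ω ∈ A e}).Adj u v → v ∈ B) →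
        4 * #S ≤ G.minDegree → 2 * #S ≤ #B} ≤ (Fintype.card V : ℝ) ^ 3 * x := by
  classical
  set n := Fintype.card V with hn
  have hx0 : 0 ≤ x := (Real.exp_pos _).le.trans hx
  have hq : 0 ≤ 1 - p := by linarith
  let W : Finset V → Finset V → Finset G.edgeSet := fun S T =>
    {e : G.edgeSet | ∃ u ∈ S, ∃ v ∉ S ∪ T, e.1 = s(u, v)}
  let I : Finset ℕ := (Icc 1 n).filter fun s => 4 * s ≤ G.minDegree
  have hW : ∀ s ∈ I, ∀ S ∈ powersetCard s (univ : Finset V), ∀ T ∈ powersetCard s univ,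
      P.real {ω | ∀ e ∈ W S T, ω ∉ A e} ≤ x ^ s := by
    intro s hs S hS T hT
    rw [mem_powersetCard] at hS hT
    have hs' := (mem_filter.1 hs).2
    rw [hA.measureReal_forall_notMem hm hp]
    have h1 := card_mul_minDegree_le (G := G) (S := S) (T := T) (by omega) (by omega)
    have h2 : (s * G.minDegree : ℝ) ≤ 2 * #(W S T) := by
      rw [hS.2] at h1
      exact_mod_cast h1
    calc (1 - p) ^ #(W S T) ≤ Real.exp (-p) ^ #(W S T) :=
          pow_le_pow_left₀ hq (Real.one_sub_le_exp_neg p) _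
      _ = Real.exp (-(p * #(W S T))) := by rw [← Real.exp_nat_mul]; ring_nf
      _ ≤ Real.exp (s * -(p * G.minDegree / 2)) := by
          refine Real.exp_le_exp.2 ?_
          nlinarith [mul_le_mul_of_nonneg_left h2 hp0]
      _ = Real.exp (-(p * G.minDegree / 2)) ^ s := Real.exp_nat_mul _ _
      _ ≤ x ^ s := pow_le_pow_left₀ (Real.exp_pos _).le hx _
  have hcard : ∀ s, (#(powersetCard s (univ : Finset V)) : ℝ) ≤ (n : ℝ) ^ s := by
    intro s
    rw [card_powersetCard, card_univ]
    exact_mod_cast Nat.choose_le_pow n s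
  calc _ ≤ P.real (⋃ s ∈ I, ⋃ S ∈ powersetCard s (univ : Finset V),
          ⋃ T ∈ powersetCard s (univ : Finset V), {ω | ∀ e ∈ W S T, ω ∉ A e}) := by
        refine measureReal_mono (fun ω hω => ?_) (measure_ne_top _ _)
        simp only [Set.mem_ofPred_eq, not_forall, not_le] at hω
        obtain ⟨S, B, hS, hSB, hadj, hsmall, hB⟩ := hω
        -- `B \ S` is padded to exactly `#S` vertices; the padding may meet `S`, which does no harm.
        obtain ⟨T, hBT, -, hT⟩ := exists_subsuperset_card_eq (s := B \ S) (t := univ) (n := #S)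
          (subset_univ _) (by rw [card_sdiff_of_subset hSB]; omega) (card_le_univ _)
        simp only [Set.mem_iUnion]
        refine ⟨#S, mem_filter.2 ⟨mem_Icc.2 ⟨hS.card_pos, card_le_univ _⟩, hsmall⟩, S, ?_, T, ?_, ?_⟩
        · simp
        · simp [hT]
        · rintro e he heA
          obtain ⟨u, hu, v, hv, he⟩ := (mem_filter.1 he).2
          refine hv (mem_union.2 ?_)
          by_cases hvS : v ∈ S
          · exact Or.inl hvS
          · refine Or.inr (hBT (mem_sdiff.2 ⟨hadj u hu v ?_, hvS⟩))
            rw [← mem_edgeSet, edgeSet_spanningSubgraphOf]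
            exact ⟨e, heA, he⟩
    _ ≤ ∑ s ∈ I, ∑ S ∈ powersetCard s (univ : Finset V),
          ∑ T ∈ powersetCard s (univ : Finset V), P.real {ω | ∀ e ∈ W S T, ω ∉ A e} :=
        (measureReal_biUnion_finset_le _ _).trans <| sum_le_sum fun s _ =>
          (measureReal_biUnion_finset_le _ _).trans <| sum_le_sum fun S _ =>
            measureReal_biUnion_finset_le _ _
    _ ≤ ∑ s ∈ I, ∑ S ∈ powersetCard s (univ : Finset V),
          ∑ T ∈ powersetCard s (univ : Finset V), x ^ s :=
        sum_le_sum fun s hs => sum_le_sum fun S hS => sum_le_sum fun T hT => hW s hs S hS T hT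
    -- There are at most `n ^ (2 * s)` pairs, and `(n ^ 2 * x) ^ s ≤ n ^ 2 * x` because `s ≥ 1`.
    _ ≤ ∑ s ∈ I, (n : ℝ) ^ 2 * x := by
        refine sum_le_sum fun s hs => ?_
        have hs1 := (mem_Icc.1 (mem_filter.1 hs).1).1
        rw [sum_const, sum_const, nsmul_eq_mul, nsmul_eq_mul, ← mul_assoc]
        calc _ ≤ (n : ℝ) ^ s * (n : ℝ) ^ s * x ^ s := by
              refine mul_le_mul_of_nonneg_right ?_ (by positivity)
              exact mul_le_mul (hcard s) (hcard s) (by positivity) (by positivity)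
          _ = ((n : ℝ) ^ 2 * x) ^ s := by rw [mul_pow, ← pow_mul, mul_comm 2 s, pow_mul]; ring
          _ ≤ _ := pow_le_of_le_one (by positivity) hx1 (by omega)
    _ ≤ n * ((n : ℝ) ^ 2 * x) := by
        rw [sum_const, nsmul_eq_mul]
        refine mul_le_mul_of_nonneg_right ?_ (by positivity)
        have : #I ≤ n := (card_filter_le _ _).trans (by simp)
        exact_mod_cast this
    _ = _ := by ring

/-- The edge sampling theorem, for a sampling probability at least `C log n / edgeConnectivity`. -/
theorem measureReal_not_connected_or_diam_gt_le [Nontrivial V] [DecidableRel G.Adj]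
    {C : ℝ} (hC : 20 ≤ C) (hl : C * Real.log (Fintype.card V) ≤ G.edgeConnectivity)
    {A : G.edgeSet → Set Ω} (hm : ∀ e, MeasurableSet (A e)) (hA : iIndepSet A P) {p : ℝ}
    (hp1 : p ≤ 1) (hp : ∀ e, P.real (A e) = p)
    (hpC : C * Real.log (Fintype.card V) ≤ p * G.edgeConnectivity) :
    P.real {ω | ¬ ((G.spanningSubgraphOf {e | ω ∈ A e}).Connected ∧
      ((G.spanningSubgraphOf {e | ω ∈ A e}).diam : ℝ) ≤
        32 * (C * Fintype.card V * Real.log (Fintype.card V) / G.minDegree))} ≤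
      (Fintype.card V : ℝ) ^ (-(1 / 4 * C) - 1) := by
  set n := Fintype.card V with hn
  have hn2 : 2 ≤ n := Fintype.one_lt_card
  have hn2' : (2 : ℝ) ≤ n := by exact_mod_cast hn2
  have hn0 : (0 : ℝ) < n := by linarith
  have hn1 : (1 : ℝ) ≤ n := by linarith
  have hlog : 0 < Real.log n := Real.log_pos (by linarith)
  have hCl : 0 < C * Real.log n := by positivity
  have hlam : (0 : ℝ) < G.edgeConnectivity := hCl.trans_le hl
  have hp0 : 0 ≤ p := by
    by_contra h
    nlinarith
  have hld : (G.edgeConnectivity : ℝ) ≤ G.minDegree := by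
    exact_mod_cast edgeConnectivity_le_minDegree
  have hd : 0 < G.minDegree := by exact_mod_cast hlam.trans_le hld
  have hq : 0 ≤ 1 - p := by linarith
  have hconn := measureReal_not_connected_le hm hA hp0 hp1 hp
  have hx : Real.exp (-(p * G.minDegree / 2)) ≤ (n : ℝ) ^ (-(C / 2)) := by
    rw [Real.rpow_def_of_pos hn0]
    refine Real.exp_le_exp.2 ?_
    nlinarith [mul_le_mul_of_nonneg_left hld hp0]
  have hx1 : (n : ℝ) ^ 2 * (n : ℝ) ^ (-(C / 2)) ≤ 1 := by
    rw [← Real.rpow_natCast, ← Real.rpow_add hn0]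
    exact Real.rpow_le_one_of_one_le_of_nonpos hn1 (by push_cast; linarith)
  have hexp := measureReal_not_expanding_le hm hA hp0 hp1 hp hx hx1
  have hb1 : (n : ℝ) ^ 2 * (1 - p) ^ G.edgeConnectivity ≤ (n : ℝ) ^ (3 - C / 2) := by
    have h1 : (1 - p) ^ G.edgeConnectivity ≤ (n : ℝ) ^ (-C) := by
      calc (1 - p) ^ G.edgeConnectivity ≤ Real.exp (-p) ^ G.edgeConnectivity :=
            pow_le_pow_left₀ hq (Real.one_sub_le_exp_neg p) _
        _ = Real.exp (-(p * G.edgeConnectivity)) := by rw [← Real.exp_nat_mul]; ring_nf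
        _ ≤ _ := by
            rw [Real.rpow_def_of_pos hn0]
            exact Real.exp_le_exp.2 (by linarith)
    calc _ ≤ (n : ℝ) ^ 2 * (n : ℝ) ^ (-C) := by gcongr
      _ = (n : ℝ) ^ (2 + -C) := by
          rw [Real.rpow_add hn0]
          norm_num
      _ ≤ _ := Real.rpow_le_rpow_of_exponent_le hn1 (by linarith)
  have hb2 : (n : ℝ) ^ 3 * (n : ℝ) ^ (-(C / 2)) = (n : ℝ) ^ (3 - C / 2) := by
    rw [sub_eq_add_neg, Real.rpow_add hn0]
    norm_num
  refine (measureReal_mono (s₂ := {ω | ¬ (G.spanningSubgraphOf {e | ω ∈ A e}).Connected} ∪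
    {ω | ¬ ∀ S B : Finset V, S.Nonempty → S ⊆ B →
      (∀ u ∈ S, ∀ v, (G.spanningSubgraphOf {e | ω ∈ A e}).Adj u v → v ∈ B) →
        4 * #S ≤ G.minDegree → 2 * #S ≤ #B}) ?_ (measure_ne_top _ _)).trans ?_
  · intro ω hω
    by_contra h
    rw [Set.mem_union, not_or] at h
    have h1 := not_not.1 h.1
    refine hω ⟨h1, (h1.diam_le_of_expansion hd (not_not.1 h.2)).trans ?_⟩
    gcongr
    exact le_mul_of_one_le_left hn0.le (by linarith)
  · refine (measureReal_union_le _ _).trans ?_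
    calc _ ≤ (n : ℝ) ^ (3 - C / 2) + (n : ℝ) ^ (3 - C / 2) :=
          add_le_add (hconn.trans hb1) (hexp.trans hb2.le)
      _ = 2 * (n : ℝ) ^ (3 - C / 2) := by ring
      _ ≤ (n : ℝ) ^ (1 : ℝ) * (n : ℝ) ^ (3 - C / 2) := by
          rw [Real.rpow_one]
          gcongr
      _ = (n : ℝ) ^ (1 + (3 - C / 2)) := (Real.rpow_add hn0 _ _).symm
      -- The inequality `4 - C / 2 ≤ -C / 4 - 1` is exactly `C ≥ 20`.
      _ ≤ _ := Real.rpow_le_rpow_of_exponent_le hn1 (by linarith)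

end SimpleGraph

/-! ### The random partition and the theorem -/

open MeasureTheory ProbabilityTheory in
/-- The events that the members of an independent family take given values are independent. -/
theorem ProbabilityTheory.iIndepFun.iIndepSet_setOf_eq {E Ω β : Type*} [MeasurableSpace Ω]
    [MeasurableSpace β] [MeasurableSingletonClass β] {P : Measure Ω} {X : E → Ω → β}
    (hX : iIndepFun X P) (i : β) : iIndepSet (fun e => {ω | X e ω = i}) P := by
  rw [iIndepSet_iff]
  intro s f hf
  refine hX.iIndep.meas_biInter fun e he => MeasurableSpace.generateFrom_le ?_ _ (hf e he)
  rintro _ rfl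
  exact ⟨{i}, measurableSet_singleton i, rfl⟩

open MeasureTheory in
-- Subadditivity suffices, so the event need not be measurable.
theorem MeasureTheory.one_sub_measureReal_setOf_not_le {Ω : Type*} [MeasurableSpace Ω]
    {P : Measure Ω} [IsProbabilityMeasure P] (p : Ω → Prop) :
    1 - P.real {ω | ¬ p ω} ≤ P.real {ω | p ω} := by
  have h := measureReal_union_le (μ := P) {ω | p ω} {ω | ¬ p ω}
  have h' : {ω | p ω} ∪ {ω | ¬ p ω} = Set.univ := by
    ext ω
    simpa using em (p ω)
  rw [h', probReal_univ] at h
  linarith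

theorem mainTheorem2 :
    ∃ C₀ a K : ℝ, 0 < C₀ ∧ 0 < a ∧ 0 < K ∧
      ∀ C : ℝ, C₀ ≤ C →
      ∀ (V : Type*) [Fintype V] [Nontrivial V] (G : SimpleGraph V) [DecidableRel G.Adj],
        C * Real.log (Fintype.card V) ≤ (G.edgeConnectivity : ℝ) →
      ∀ (Ω : Type*) [MeasurableSpace Ω] (P : MeasureTheory.Measure Ω)
        [MeasureTheory.IsProbabilityMeasure P],
        -- sampling every edge independently with probability `C log n / lambda`
        (∀ A : G.edgeSet → Set Ω,
          (∀ e, MeasurableSet (A e)) →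
          ProbabilityTheory.iIndepSet A P →
          (∀ e, P.real (A e) = C * Real.log (Fintype.card V) / (G.edgeConnectivity : ℝ)) →
          1 - (Fintype.card V : ℝ) ^ (-(a * C)) ≤
            P.real {ω | (G.spanningSubgraphOf {e | ω ∈ A e}).Connected ∧
              ((G.spanningSubgraphOf {e | ω ∈ A e}).diam : ℝ) ≤
                K * (C * Fintype.card V * Real.log (Fintype.card V) / G.minDegree)}) ∧
        -- putting every edge independently into a uniformly random part
        (∀ X : G.edgeSet → Ω →
            Fin ⌊(G.edgeConnectivity : ℝ) / (C * Real.log (Fintype.card V))⌋₊,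
          (∀ e, Measurable (X e)) →
          ProbabilityTheory.iIndepFun X P →
          (∀ e i, P.real {ω | X e ω = i} =
            1 / (⌊(G.edgeConnectivity : ℝ) / (C * Real.log (Fintype.card V))⌋₊ : ℝ)) →
          1 - (Fintype.card V : ℝ) ^ (-(a * C)) ≤
            P.real {ω | ∀ i,
              (G.spanningSubgraphOf {e | X e ω = i}).Connected ∧
              ((G.spanningSubgraphOf {e | X e ω = i}).diam : ℝ) ≤
                K * (C * Fintype.card V * Real.log (Fintype.card V) / G.minDegree)}) := by
  refine ⟨20, 1 / 4, 32, by norm_num, by norm_num, by norm_num, ?_⟩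
  intro C hC V _ _ G _ hl Ω _ P _
  set n := Fintype.card V with hn
  have hn2 : 2 ≤ n := Fintype.one_lt_card
  have hn2' : (2 : ℝ) ≤ n := by exact_mod_cast hn2
  have hn0 : (0 : ℝ) < n := by linarith
  have hn1 : (1 : ℝ) ≤ n := by linarith
  have hlog2 : (0.6931471803 : ℝ) < Real.log 2 := Real.log_two_gt_d9
  have hlog : Real.log 2 ≤ Real.log n := Real.log_le_log (by norm_num) hn2'
  have hCl : 1 ≤ C * Real.log n := by nlinarith
  have hCl0 : 0 < C * Real.log n := by linarith
  have hlam : (0 : ℝ) < G.edgeConnectivity := hCl0.trans_le hl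
  constructor
  · intro A hm hA hp
    refine le_trans ?_ (MeasureTheory.one_sub_measureReal_setOf_not_le _)
    refine sub_le_sub_left ((SimpleGraph.measureReal_not_connected_or_diam_gt_le hC hl hm hA
      ((div_le_one hlam).2 hl) hp (div_mul_cancel₀ _ hlam.ne').ge).trans ?_) 1
    exact Real.rpow_le_rpow_of_exponent_le hn1 (by linarith)
  · set k := ⌊(G.edgeConnectivity : ℝ) / (C * Real.log n)⌋₊ with hk
    intro X hm hX hp
    have hk1 : 1 ≤ k := Nat.le_floor (by rw [Nat.cast_one]; exact (one_le_div hCl0).2 hl)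
    have hk0 : (0 : ℝ) < k := by exact_mod_cast hk1
    have hkle : (k : ℝ) ≤ (G.edgeConnectivity : ℝ) / (C * Real.log n) :=
      Nat.floor_le (by positivity)
    -- Uses `λ ≤ δ < n` together with `C log n ≥ 1`.
    have hkn : (k : ℝ) ≤ n := by
      have h1 : (G.edgeConnectivity : ℝ) ≤ G.minDegree := by
        exact_mod_cast SimpleGraph.edgeConnectivity_le_minDegree
      have h2 : (G.minDegree : ℝ) ≤ n := by
        obtain ⟨v⟩ : Nonempty V := inferInstance
        exact_mod_cast (G.minDegree_le_degree v).trans (G.degree_lt_card_verts v).le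
      exact hkle.trans ((div_le_self hlam.le hCl).trans (h1.trans h2))
    refine le_trans ?_ (MeasureTheory.one_sub_measureReal_setOf_not_le _)
    refine sub_le_sub_left ?_ 1
    have hbad := fun i => SimpleGraph.measureReal_not_connected_or_diam_gt_le (P := P) hC hl
      (A := fun e => {ω | X e ω = i}) (fun e => hm e (MeasurableSet.singleton i))
      (hX.iIndepSet_setOf_eq i) (p := 1 / (k : ℝ))
      ((div_le_one hk0).2 (by exact_mod_cast hk1)) (fun e => hp e i) (by
        rw [one_div, inv_mul_eq_div, le_div_iff₀ hk0, mul_comm]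
        exact (le_div_iff₀ hCl0).1 hkle)
    simp only [not_forall, Set.ofPred_exists]
    refine (MeasureTheory.measureReal_iUnion_fintype_le _).trans
      ((Finset.sum_le_sum fun i _ => hbad i).trans ?_)
    rw [Finset.sum_const, Finset.card_univ, Fintype.card_fin, nsmul_eq_mul]
    -- The spare `-1` in the exponent pays for the union bound over the `k ≤ n` classes.
    calc (k : ℝ) * (n : ℝ) ^ (-(1 / 4 * C) - 1)
        ≤ (n : ℝ) ^ (1 : ℝ) * (n : ℝ) ^ (-(1 / 4 * C) - 1) := by
          rw [Real.rpow_one]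
          gcongr
      _ = (n : ℝ) ^ (-(1 / 4 * C)) := by
          rw [← Real.rpow_add hn0]
          congr 1
          ring
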